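/- **The instance.** Let $0<\Delta\le 0.04$. Consider the probabilistic maximum coverage problem on the bipartite graph with left nodes $u_1,u_2,u_3,u_4$, right nodes $v_1,v_2$, and six weighted edges $$\mu_{(u_1,v_1)}=0.49,\quad \mu_{(u_2,v_1)}=0.2,\quad \mu_{(u_2,v_2)}=0.3,\quad \mu_{(u_3,v_1)}=0.3,\quad \mu_{(u_3,v_2)}=0.2-\Delta,\quad \mu_{(u_4,v_2)}=0.48 .$$ Each edge is a base arm, and the edges leaving $u_j$ form a unit, identified with $u_j$. An action is a set of $K=2$ units. For a set $S$ of units and $w\in\mathbb R^{6}$ put $$r(S,w)=\sum_{v\in\{v_1,v_2\}}\Bigl(1-\prod_{(u,v)\in E,\ u\in S}(1-w_{(u,v)})\Bigr).$$ Whenever a base arm $i$ is observed, its output is exactly its mean $\mu_i$. **Greedy.** On input $w$, $\mathtt{Greedy}$ chooses a unit $s_1$ maximizing $r(\{s\},w)$, then a unit $s_2\ne s_1$ maximizing $r(\{s_1,s\},w)$ (ties broken arbitrarily), and returns $\{s_1,s_2\}$. **The algorithm (CTS with Gaussian priors and $\mathtt{Greedy}$).** Initialization: for each unit $s$, play one arbitrary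 action containing $s$. Let $N_{1,i}$ be the number of observations of base arm $i$ in this phase and $\hat\mu_{1,i}$ their average. In each round $t=1,2,\dots$, given the history of the earlier rounds, sample independently $\theta_{t,i}\sim\mathcal N(\hat\mu_{t,i},1/N_{t,i})$ for every base arm $i$, play $S_t=\mathtt{Greedy}(\theta_t)$, observe the output $X_{t,i}=\mu_i$ of every base arm $i$ in the units of $S_t$, and for these arms set $\hat\mu_{t+1,i}=(\hat\mu_{t,i}N_{t,i}+X_{t,i})/(N_{t,i}+1)$ and $N_{t+1,i}=N_{t,i}+1$; for the other arms nothing changes. **Claim.** On input $\mu$, $\mathtt{Greedy}$ has exactly one possible run: it chooses $s_{g,1}=u_2$ first and $s_{g,2}=u_1$ second, so $S_g=\{u_2,u_1\}$. For a unit $s$ let $\Delta_{s,1}=r(\{u_2\},\mu)-r(\{s\},\mu)$. There is a constant $c>0$, not depending on $\Delta$, such that for every $0<\Delta\le 0.04$ there is a $T_0$ such that for all $T\ge T_0$ (and for all choices in the initialization phase): 1. for every unit $s\ne u_2$, $$\mathbb E\Bigl[\sum_{t=1}^T \mathbf 1\{s\in S_t\}\Bigr]\ \ge\ c\,\frac{\log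 T}{\Delta_{s,1}^2};$$ 2. the cumulative greedy regret $R_g(T)=\mathbb E\bigl[\sum_{t=1}^T\max\{r(S_g,\mu)-r(S_t,\mu),0\}\bigr]$ satisfies $$R_g(T)\ \ge\ c\,\frac{\log T}{\Delta_{u_3,1}^2}\qquad\text{and}\qquad R_g(T)\ \ge\ c\,\frac{\log T}{\Delta^2}.$$ -/

import Mathlib

open MeasureTheory ProbabilityTheory

noncomputable section

namespace CMAB

/-! ### The greedy oracle, gaps -/

section Greedy

variable {U ι : Type*} [DecidableEq U] {K : ℕ}

/-- The set of the units chosen strictly before step `k`. -/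
def before (s : Fin K → U) (k : Fin K) : Finset U := (Finset.Iio k).image s

/-- `s` is a sequence of units that the greedy oracle may choose on input `w`, for the expected
reward function `r` and action size `K`: in every step the chosen unit maximizes the reward of the
enlarged set among all units not chosen before. -/
def IsGreedySeq (r : Finset U → (ι → ℝ) → ℝ) (w : ι → ℝ) (s : Fin K → U) : Prop :=
  ∀ k : Fin K, s k ∉ before s k ∧
    ∀ u : U, u ∉ before s k → r (insert u (before s k)) w ≤ r (insert (s k) (before s k)) w

/-- The action (set of `K` units) formed by a sequence of units. -/
def action (s : Fin K → U) : Finset U := Finset.univ.image s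

/-- The marginal reward gap of the unit `u` in step `k` with respect to the greedy sequence `g`
(steps are numbered from `0`). -/
def marginalGap (r : Finset U → (ι → ℝ) → ℝ) (w : ι → ℝ) (g : Fin K → U) (u : U) (k : Fin K) : ℝ :=
  r (insert (g k) (before g k)) w - r (insert u (before g k)) w

end Greedy

/-! ### Combinatorial Thompson sampling with Gaussian priors -/

section Algorithm

variable {U ι Ω : Type*} [DecidableEq U]

/-- Before the first round the algorithm plays, for every unit `s`, an action `init s` of `K` units
containing `s`. -/
def IsInit (K : ℕ) (init : U → Finset U) : Prop := ∀ s : U, (init s).card = K ∧ s ∈ init s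

/-- The statistics kept for every base arm: number of observations and empirical mean. -/
structure Stats (ι : Type*) where
  /-- number of observations -/
  count : ι → ℕ
  /-- empirical mean -/
  mean : ι → ℝ

/-- The statistics after the initialization phase; `unit i` is the unit that contains the base
arm `i`, and `x i` is the (deterministic) output of base arm `i`. -/
def initStats [Fintype U] (unit : ι → U) (x : ι → ℝ) (init : U → Finset U) : Stats ι where
  count i := (Finset.univ.filter fun s : U => unit i ∈ init s).card
  mean i := (∑ _s ∈ Finset.univ.filter (fun s : U => unit i ∈ init s), x i) /
    ((Finset.univ.filter fun s : U => unit i ∈ init s).card : ℝ)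

/-- The update after the action `A` has been played: the base arms in the units of `A` are
observed. -/
def updateStats (unit : ι → U) (x : ι → ℝ) (A : Finset U) (σ : Stats ι) : Stats ι where
  count i := if unit i ∈ A then σ.count i + 1 else σ.count i
  mean i := if unit i ∈ A then (σ.mean i * σ.count i + x i) / (σ.count i + 1) else σ.mean i

/-- The statistics at the beginning of round `t` (rounds are numbered from `0`) when the actions
`A 0, A 1, …` are played. -/
def stats [Fintype U] (unit : ι → U) (x : ι → ℝ) (init : U → Finset U) (A : ℕ → Finset U) :
    ℕ → Stats ι
  | 0 => initStats unit x init
  | t + 1 => updateStats unit x (A t) (stats unit x init A t)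

/-- The sampling distribution: independent Gaussians, base arm `i` having the empirical mean as mean
and the inverse of the number of observations as variance. -/
def posterior [Fintype ι] (σ : Stats ι) : Measure (ι → ℝ) :=
  Measure.pi fun i => gaussianReal (σ.mean i) ((σ.count i : NNReal)⁻¹)

/-- The σ-algebra of the history before round `t`. As outputs are deterministic, the observations
are functions of the actions, so it is generated by the actions of the earlier rounds. -/
@[reducible] def history (S : ℕ → Ω → Finset U) (t : ℕ) : MeasurableSpace Ω :=
  ⨆ τ : Fin t, MeasurableSpace.comap (S τ) ⊤

/-- `(θ, S)` is a run, on the probability space `(Ω, P)`, of combinatorial Thompson sampling with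
Gaussian priors and the greedy oracle, when base arm `i` always outputs `x i`: in every round `t`
the parameter `θ t` is drawn, given the history, from the current posterior, and then the action
`S t` returned by the greedy oracle on input `θ t` is played. -/
structure IsCTSRun [Fintype U] [Fintype ι] [MeasurableSpace Ω] (P : Measure Ω)
    (unit : ι → U) (r : Finset U → (ι → ℝ) → ℝ) (K : ℕ) (x : ι → ℝ) (init : U → Finset U)
    (θ : ℕ → Ω → ι → ℝ) (S : ℕ → Ω → Finset U) : Prop where
  measurable_param : ∀ t, Measurable (θ t)
  measurable_action : ∀ t (A : Finset U), MeasurableSet {ω | S t ω = A}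
  condLaw_param : ∀ t (B : Set (ι → ℝ)), MeasurableSet B →
    P[(θ t ⁻¹' B).indicator (fun _ => (1 : ℝ)) | history S t] =ᵐ[P]
      fun ω => (posterior (stats unit x init (fun τ => S τ ω) t)).real B
  greedy : ∀ t ω, ∃ s : Fin K → U, IsGreedySeq r (θ t ω) s ∧ S t ω = action s

/-- The expected number of rounds, among the first `T`, in which the unit `s` is selected. -/
def expectedSelections [MeasurableSpace Ω] (P : Measure Ω) (S : ℕ → Ω → Finset U) (s : U) (T : ℕ) :
    ℝ :=
  ∫ ω, ∑ t ∈ Finset.range T, (if s ∈ S t ω then (1 : ℝ) else 0) ∂P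

/-- The cumulative greedy regret over `T` rounds with respect to the action `Sg`, for the mean
vector `w`. -/
def greedyRegret [MeasurableSpace Ω] (P : Measure Ω) (r : Finset U → (ι → ℝ) → ℝ) (w : ι → ℝ)
    (Sg : Finset U) (S : ℕ → Ω → Finset U) (T : ℕ) : ℝ :=
  ∫ ω, ∑ t ∈ Finset.range T, max (r Sg w - r (S t ω) w) 0 ∂P

end Algorithm

/-! ### Probabilistic maximum coverage -/

section PMC

variable {L R : Type*} [Fintype R] [DecidableEq L] [DecidableEq R]

/-- The expected reward in the probabilistic maximum coverage problem on the bipartite graph with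
edge set `E ⊆ L × R` and edge weights `w`. -/
def pmcReward (E : Finset (L × R)) (S : Finset L) (w : E → ℝ) : ℝ :=
  ∑ v : R, (1 - ∏ e : E with e.1.2 = v ∧ e.1.1 ∈ S, (1 - w e))

/-- In the probabilistic maximum coverage problem the edges are the base arms, and the edges leaving
a node of `L` form the unit of this node. -/
def pmcUnit (E : Finset (L × R)) (e : E) : L := e.1.1

end PMC

/-! ### The instance -/

/-- The node `u₁`. -/
abbrev u₁ : Fin 4 := 0
/-- The node `u₂`. -/
abbrev u₂ : Fin 4 := 1
/-- The node `u₃`. -/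
abbrev u₃ : Fin 4 := 2
/-- The node `u₄`. -/
abbrev u₄ : Fin 4 := 3
/-- The node `v₁`. -/
abbrev v₁ : Fin 2 := 0
/-- The node `v₂`. -/
abbrev v₂ : Fin 2 := 1

/-- The edges of the instance. -/
def edges : Finset (Fin 4 × Fin 2) :=
  {(u₁, v₁), (u₂, v₁), (u₂, v₂), (u₃, v₁), (u₃, v₂), (u₄, v₂)}

/-- The matrix of edge weights (rows `u₁, …, u₄`, columns `v₁, v₂`); the two zero entries are not
edges and are never used. -/
def weightMatrix (Δ : ℝ) : Matrix (Fin 4) (Fin 2) ℝ :=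
  !![0.49, 0; 0.2, 0.3; 0.3, 0.2 - Δ; 0, 0.48]

/-- The mean vector of the instance. -/
def weights (Δ : ℝ) (e : edges) : ℝ := weightMatrix Δ e.1.1 e.1.2

end CMAB

end

/-!
Outputs are deterministic, so the empirical mean of every base arm is always its true mean, and
the state of the algorithm is described by the numbers of observations alone. A unit `s ≠ u₂` is
chosen first by greedy as soon as its samples overshoot their means by more than
`δ = r({u₂}, μ) - r({s}, μ)` while no other arm exceeds its mean, because the reward of a
single unit is the sum of its weights (`pmcReward_singleton`, `mem_action_of_favourable`). Given the
history this happens with probability at least `κ ^ 6 * exp (- δ² N)`, where `N` is the number of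
observations of `s` and `κ` is an absolute constant (`posterior_real_favourable_ge`).

Put `ℓ = log T / (2 δ²)`. If `s` is selected more than `ℓ` times with probability at least one
half, then its expected number of selections is at least `ℓ / 2`. Otherwise, in each of the `T`
rounds it has been selected at most `ℓ` times with probability at least one half, so each round
selects it with probability of order `T ^ (-1/2)`, which gives of order `T ^ (1/2)` selections in
expectation (`min_le_expectedSelections`, `eventually_log_div_le`).

Finally, every action of two units that contains `u₃` has greedy regret at least `0.008`, and the
first-step gap of `u₃` is `Δ`, so both regret bounds follow from the bound for the selections of
`u₃`.
-/

namespace CMAB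

/-! ### Lower bounds for Gaussian probabilities -/

/-- The constant `(2π)^(-1/2) e⁻¹`, a lower bound for the probability that a Gaussian variable lies
between its mean and its mean plus one standard deviation. -/
noncomputable def gaussianConst : ℝ := (√(2 * Real.pi))⁻¹ * Real.exp (-1)

lemma gaussianConst_pos : 0 < gaussianConst := by
  unfold gaussianConst
  have := Real.pi_pos
  positivity

/-- The density is bounded below on an interval of length one standard deviation, using
`(δ + σ)² ≤ 2 δ² + 2 σ²`. -/
lemma gaussianReal_real_Ioc_ge (m δ a : ℝ) {n : ℕ} (hn : 1 ≤ n)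
    (h : ∀ x ∈ Set.Ioc a (a + (√n)⁻¹), |x - m| ≤ δ + (√n)⁻¹) :
    gaussianConst * Real.exp (-(δ ^ 2 * n)) ≤
      (gaussianReal m ((n : NNReal)⁻¹)).real (Set.Ioc a (a + (√n)⁻¹)) := by
  have hn0 : (0 : ℝ) < n := by exact_mod_cast hn
  have hs : 0 < √(n : ℝ) := Real.sqrt_pos.2 hn0
  have hss : √(n : ℝ) ^ 2 = n := Real.sq_sqrt hn0.le
  have hv : ((n : NNReal)⁻¹) ≠ 0 := by
    have : (n : NNReal) ≠ 0 := by exact_mod_cast (by omega : n ≠ 0)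
    exact inv_ne_zero this
  rw [measureReal_def, gaussianReal_apply_eq_integral _ hv, ENNReal.toReal_ofReal
    (integral_nonneg fun x => gaussianPDFReal_nonneg _ _ x)]
  have hlow : ∀ x ∈ Set.Ioc a (a + (√n)⁻¹),
      √n * (gaussianConst * Real.exp (-(δ ^ 2 * n))) ≤
        gaussianPDFReal m ((n : NNReal)⁻¹) x := by
    intro x hx
    have h1 := h x hx
    have h2 : (x - m) ^ 2 ≤ 2 * δ ^ 2 + 2 * ((n : ℝ))⁻¹ := by
      have h3 : (x - m) ^ 2 ≤ (δ + (√n)⁻¹) ^ 2 := by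
        rw [← sq_abs]
        exact pow_le_pow_left₀ (abs_nonneg _) h1 2
      have h4 : ((√(n : ℝ))⁻¹) ^ 2 = (n : ℝ)⁻¹ := by rw [inv_pow, hss]
      nlinarith [sq_nonneg (δ - (√(n : ℝ))⁻¹)]
    have h5 : (√(2 * Real.pi * ((n : ℝ))⁻¹))⁻¹ = √n * (√(2 * Real.pi))⁻¹ := by
      rw [Real.sqrt_mul (by positivity), Real.sqrt_inv, mul_inv, inv_inv, mul_comm]
    have h6 : Real.exp (-1) * Real.exp (-(δ ^ 2 * n)) ≤
        Real.exp (-(x - m) ^ 2 / (2 * (n : ℝ)⁻¹)) := by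
      rw [← Real.exp_add]
      apply Real.exp_le_exp.2
      have h7 : -(x - m) ^ 2 / (2 * (n : ℝ)⁻¹) = -((x - m) ^ 2 * n / 2) := by field_simp
      have h8 : (x - m) ^ 2 * n ≤ (2 * δ ^ 2 + 2 * ((n : ℝ))⁻¹) * n :=
        mul_le_mul_of_nonneg_right h2 hn0.le
      have h9 : (2 * δ ^ 2 + 2 * ((n : ℝ))⁻¹) * n = 2 * δ ^ 2 * n + 2 := by field_simp
      rw [h7]
      linarith
    rw [gaussianPDFReal_def]
    push_cast
    rw [h5, gaussianConst, mul_assoc, mul_assoc]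
    gcongr
  have := setIntegral_mono_on (μ := volume) (s := Set.Ioc a (a + (√n)⁻¹))
    (integrable_const _) (integrable_gaussianPDFReal m _).integrableOn measurableSet_Ioc hlow
  refine le_trans (le_of_eq ?_) this
  rw [setIntegral_const, smul_eq_mul, measureReal_def, Real.volume_Ioc, add_sub_cancel_left,
    ENNReal.toReal_ofReal (by positivity), ← mul_assoc, inv_mul_cancel₀ hs.ne', one_mul]

lemma gaussianReal_real_Ioi_ge (m : ℝ) {δ : ℝ} (hδ : 0 ≤ δ) {n : ℕ} (hn : 1 ≤ n) :
    gaussianConst * Real.exp (-(δ ^ 2 * n)) ≤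
      (gaussianReal m ((n : NNReal)⁻¹)).real (Set.Ioi (m + δ)) := by
  refine (gaussianReal_real_Ioc_ge m δ (m + δ) hn fun x hx => ?_).trans
    (measureReal_mono Set.Ioc_subset_Ioi_self)
  rw [abs_le]
  constructor <;> linarith [hx.1, hx.2]

lemma gaussianReal_real_Ici_ge (m : ℝ) {n : ℕ} (hn : 1 ≤ n) :
    gaussianConst ≤ (gaussianReal m ((n : NNReal)⁻¹)).real (Set.Ici m) := by
  have := gaussianReal_real_Ioi_ge m le_rfl hn
  simp only [ne_eq, OfNat.ofNat_ne_zero, not_false_eq_true, zero_pow, zero_mul, neg_zero,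
    Real.exp_zero, mul_one, add_zero] at this
  exact this.trans (measureReal_mono Set.Ioi_subset_Ici_self)

lemma gaussianReal_real_Iic_ge (m : ℝ) {n : ℕ} (hn : 1 ≤ n) :
    gaussianConst ≤ (gaussianReal m ((n : NNReal)⁻¹)).real (Set.Iic m) := by
  have := gaussianReal_real_Ioc_ge m 0 (m - (√n)⁻¹) hn fun x hx => by
    rw [abs_le]
    constructor <;> linarith [hx.1, hx.2]
  simp only [ne_eq, OfNat.ofNat_ne_zero, not_false_eq_true, zero_pow, zero_mul, neg_zero,
    Real.exp_zero, mul_one, sub_add_cancel] at this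
  exact this.trans (measureReal_mono Set.Ioc_subset_Iic_self)

/-! ### The statistics when outputs are deterministic -/

section Stats

variable {U ι : Type*} [DecidableEq U] [Fintype U]

lemma mean_stats (unit : ι → U) (x : ι → ℝ) {K : ℕ} {init : U → Finset U} (hinit : IsInit K init)
    (A : ℕ → Finset U) (t : ℕ) (i : ι) : (stats unit x init A t).mean i = x i := by
  induction t with
  | zero =>
    have : ((Finset.univ.filter fun s : U => unit i ∈ init s).card : ℝ) ≠ 0 := by
      rw [Nat.cast_ne_zero]
      exact Finset.card_ne_zero.2 ⟨unit i, by simp [(hinit (unit i)).2]⟩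
    simp only [stats, initStats, Finset.sum_const, nsmul_eq_mul]
    field_simp
  | succ t ih =>
    simp only [stats, updateStats, ih]
    split_ifs
    · have : ((stats unit x init A t).count i : ℝ) + 1 ≠ 0 := by positivity
      field_simp
    · rfl

lemma one_le_count_stats (unit : ι → U) (x : ι → ℝ) {K : ℕ} {init : U → Finset U}
    (hinit : IsInit K init) (A : ℕ → Finset U) (t : ℕ) (i : ι) :
    1 ≤ (stats unit x init A t).count i := by
  induction t with
  | zero => exact Finset.card_pos.2 ⟨unit i, by simp [(hinit (unit i)).2]⟩
  | succ t ih =>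
    simp only [stats, updateStats]
    split_ifs <;> omega

lemma count_stats_le (unit : ι → U) (x : ι → ℝ) (init : U → Finset U)
    (A : ℕ → Finset U) (t : ℕ) (i : ι) :
    ((stats unit x init A t).count i : ℝ) ≤
      (∑ τ ∈ Finset.range t, if unit i ∈ A τ then (1 : ℝ) else 0) + Fintype.card U := by
  induction t with
  | zero =>
    simp only [stats, initStats, Finset.range_zero, Finset.sum_empty, zero_add]
    exact_mod_cast Finset.card_le_univ _
  | succ t ih =>
    rw [Finset.sum_range_succ]
    simp only [stats, updateStats]
    split_ifs
    · push_cast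
      linarith
    · linarith

end Stats

/-- The samples of the arms in `p` are at least their means, that of `i₀` by more than `δ`, and the
samples of the remaining arms are at most their means. -/
def favourable {ι : Type*} (x : ι → ℝ) (p : ι → Prop) (i₀ : ι) (δ : ℝ) : Set (ι → ℝ) :=
  {w | x i₀ + δ < w i₀ ∧ ∀ i, (p i → x i ≤ w i) ∧ (¬ p i → w i ≤ x i)}

lemma measurableSet_favourable {ι : Type*} [Fintype ι] (x : ι → ℝ) (p : ι → Prop) (i₀ : ι)
    (δ : ℝ) : MeasurableSet (favourable x p i₀ δ) := by
  classical
  have hset : favourable x p i₀ δ = {w | x i₀ + δ < w i₀} ∩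
      ⋂ i, {w | (p i → x i ≤ w i) ∧ (¬ p i → w i ≤ x i)} := by
    ext w
    simp [favourable]
  rw [hset]
  refine (measurableSet_lt measurable_const (measurable_pi_apply i₀)).inter
    (MeasurableSet.iInter fun i => ?_)
  by_cases hp : p i
  · simpa [hp] using measurableSet_le measurable_const (measurable_pi_apply i)
  · simpa [hp] using measurableSet_le (measurable_pi_apply i) measurable_const

lemma posterior_real_favourable_ge {ι : Type*} [Fintype ι] (σ : Stats ι)
    (hσ : ∀ i, 1 ≤ σ.count i) {p : ι → Prop} {i₀ : ι} (hp : p i₀) {δ : ℝ} (hδ : 0 ≤ δ) :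
    gaussianConst ^ Fintype.card ι * Real.exp (-(δ ^ 2 * σ.count i₀)) ≤
      (posterior σ).real (favourable σ.mean p i₀ δ) := by
  classical
  let f : ι → Set ℝ := fun i => if i = i₀ then Set.Ioi (σ.mean i + δ) else
    if p i then Set.Ici (σ.mean i) else Set.Iic (σ.mean i)
  have hsub : Set.univ.pi f ⊆ favourable σ.mean p i₀ δ := by
    intro w hw
    have h0 : σ.mean i₀ + δ < w i₀ := by simpa [f] using hw i₀ trivial
    refine ⟨h0, fun i => ?_⟩
    have hi := hw i trivial
    by_cases h : i = i₀
    · subst h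
      exact ⟨fun _ => by linarith, fun h => absurd hp h⟩
    · by_cases hpi : p i
      · simpa [f, h, hpi] using hi
      · simpa [f, h, hpi] using hi
  have : IsProbabilityMeasure (posterior σ) := by unfold posterior; infer_instance
  refine le_trans ?_ (measureReal_mono hsub)
  have hpi : (posterior σ).real (Set.univ.pi f) =
      ∏ i, (gaussianReal (σ.mean i) ((σ.count i : NNReal)⁻¹)).real (f i) := by
    simp only [measureReal_def, posterior, Measure.pi_pi, ENNReal.toReal_prod]
  rw [hpi, ← Finset.mul_prod_erase _ _ (Finset.mem_univ i₀)]
  have hcard : gaussianConst ^ Fintype.card ι =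
      gaussianConst * ∏ _i ∈ Finset.univ.erase i₀, gaussianConst := by
    rw [Finset.mul_prod_erase (a := i₀) _ (fun _ => gaussianConst) (Finset.mem_univ i₀)]
    simp
  rw [hcard, mul_right_comm]
  have hκ := gaussianConst_pos
  refine mul_le_mul ?_ ?_ (Finset.prod_nonneg fun _ _ => hκ.le) measureReal_nonneg
  · simpa [f] using gaussianReal_real_Ioi_ge (σ.mean i₀) hδ (hσ i₀)
  · refine Finset.prod_le_prod (fun _ _ => hκ.le) fun i hi => ?_
    have hne := Finset.ne_of_mem_erase hi
    by_cases hpi : p i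
    · simpa [f, hne, hpi] using gaussianReal_real_Ici_ge (σ.mean i) (hσ i)
    · simpa [f, hne, hpi] using gaussianReal_real_Iic_ge (σ.mean i) (hσ i)

/-! ### The first greedy choice in probabilistic maximum coverage -/

section FirstChoice

variable {L R : Type*} [Fintype R] [DecidableEq L] [DecidableEq R]

/-- A single left node covers every right node by at most one edge, so its reward is linear in the
weights. -/
lemma pmcReward_singleton (E : Finset (L × R)) (u : L) (w : E → ℝ) :
    pmcReward E {u} w = ∑ e : E with e.1.1 = u, w e := by
  have h : ∀ v : R, (1 - ∏ e : E with e.1.2 = v ∧ e.1.1 ∈ ({u} : Finset L), (1 - w e)) =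
      ∑ e : E with e.1.1 = u ∧ e.1.2 = v, w e := by
    intro v
    have hfil : (Finset.univ.filter fun e : E => e.1.2 = v ∧ e.1.1 ∈ ({u} : Finset L)) =
        Finset.univ.filter fun e : E => e.1.1 = u ∧ e.1.2 = v := by
      ext e
      simp [and_comm]
    rw [hfil]
    have hcard : (Finset.univ.filter fun e : E => e.1.1 = u ∧ e.1.2 = v).card ≤ 1 := by
      refine Finset.card_le_one.2 fun a ha b hb => ?_
      simp only [Finset.mem_filter, Finset.mem_univ, true_and] at ha hb
      exact Subtype.ext (Prod.ext (ha.1.trans hb.1.symm) (ha.2.trans hb.2.symm))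
    rcases Nat.le_one_iff_eq_zero_or_eq_one.1 hcard with h0 | h1
    · rw [Finset.card_eq_zero.1 h0]
      simp
    · obtain ⟨e, he⟩ := Finset.card_eq_one.1 h1
      rw [he]
      simp
  unfold pmcReward
  simp_rw [h]
  rw [← Finset.sum_fiberwise (Finset.univ.filter fun e : E => e.1.1 = u) (fun e => e.1.2) w]
  simp only [Finset.filter_filter]

/-- If the arms of `s` overshoot their means by more than the gap of `s` and no other arm exceeds
its mean, then greedy chooses `s` first. -/
lemma mem_action_of_favourable {E : Finset (L × R)} {x w : E → ℝ} {e₀ : E} {δ : ℝ}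
    (hgap : ∀ u, pmcReward E {u} x - pmcReward E {e₀.1.1} x ≤ δ)
    (hw : w ∈ favourable x (fun e => pmcUnit E e = e₀.1.1) e₀ δ)
    {K : ℕ} [NeZero K] {g : Fin K → L} (hg : IsGreedySeq (pmcReward E) w g) :
    e₀.1.1 ∈ action g := by
  have hb : before g 0 = ∅ := by
    have : Finset.Iio (0 : Fin K) = ∅ := by
      ext k
      simp
    simp [before, this]
  suffices h : g 0 = e₀.1.1 from Finset.mem_image.2 ⟨0, Finset.mem_univ _, h⟩
  by_contra hne
  have h1 := (hg 0).2 e₀.1.1 (by simp [hb])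
  rw [hb, insert_empty_eq, insert_empty_eq] at h1
  have h2 : pmcReward E {g 0} w ≤ pmcReward E {g 0} x := by
    rw [pmcReward_singleton, pmcReward_singleton]
    refine Finset.sum_le_sum fun e he => (hw.2 e).2 fun h => hne ?_
    rw [← (Finset.mem_filter.1 he).2]
    exact h
  have h3 : pmcReward E {e₀.1.1} x + δ < pmcReward E {e₀.1.1} w := by
    have hmem : e₀ ∈ Finset.univ.filter fun e : E => e.1.1 = e₀.1.1 := by simp
    rw [pmcReward_singleton, pmcReward_singleton, ← Finset.add_sum_erase _ _ hmem,
      ← Finset.add_sum_erase _ _ hmem]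
    have h4 : ∑ e ∈ (Finset.univ.filter fun e : E => e.1.1 = e₀.1.1).erase e₀, x e ≤
        ∑ e ∈ (Finset.univ.filter fun e : E => e.1.1 = e₀.1.1).erase e₀, w e :=
      Finset.sum_le_sum fun e he =>
        (hw.2 e).1 (Finset.mem_filter.1 (Finset.mem_of_mem_erase he)).2
    linarith [hw.1]
  linarith [hgap (g 0)]

end FirstChoice

/-! ### Lower bound for the number of selections -/

section Selections

variable {L R Ω : Type*}

section Measurability

variable [Fintype L] [MeasurableSpace Ω]

lemma measurable_of_measurableSet_eq {S : Ω → Finset L}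
    (hS : ∀ A : Finset L, MeasurableSet {ω | S ω = A}) : Measurable[_, ⊤] S := by
  refine @measurable_to_countable' _ _ ⊤ _ _ _ fun A => ?_
  exact hS A

lemma history_le {S : ℕ → Ω → Finset L}
    (hS : ∀ t (A : Finset L), MeasurableSet {ω | S t ω = A}) (t : ℕ) :
    history S t ≤ ‹MeasurableSpace Ω› :=
  iSup_le fun τ => (measurable_of_measurableSet_eq (hS τ)).comap_le

lemma integrable_comp_action {P : Measure Ω} [IsFiniteMeasure P] {S : Ω → Finset L}
    (hS : ∀ A : Finset L, MeasurableSet {ω | S ω = A}) (f : Finset L → ℝ) :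
    Integrable (fun ω => f (S ω)) P := by
  have hm : Measurable fun ω => f (S ω) :=
    (@measurable_from_top _ _ _ f).comp (measurable_of_measurableSet_eq hS)
  refine Integrable.of_bound hm.aestronglyMeasurable (∑ A, ‖f A‖) (ae_of_all _ fun ω => ?_)
  exact Finset.single_le_sum (f := fun A => ‖f A‖) (fun _ _ => norm_nonneg _)
    (Finset.mem_univ (S ω))

end Measurability

variable [DecidableEq L]

/-- The number of rounds before round `t` in which the unit `s` is selected. -/
noncomputable def selections (S : ℕ → Ω → Finset L) (s : L) (t : ℕ) (ω : Ω) : ℝ :=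
  ∑ τ ∈ Finset.range t, if s ∈ S τ ω then (1 : ℝ) else 0

lemma selections_mono (S : ℕ → Ω → Finset L) (s : L) (ω : Ω) :
    Monotone fun t => selections S s t ω := by
  refine monotone_nat_of_le_succ fun t => ?_
  simp only [selections, Finset.sum_range_succ]
  split_ifs <;> simp

lemma measurable_selections_history (S : ℕ → Ω → Finset L) (s : L) (t : ℕ) :
    Measurable[history S t] (selections S s t) := by
  unfold selections
  refine Finset.measurable_fun_sum _ fun τ hτ => ?_
  have h1 : Measurable[history S t, ⊤] (S τ) := by
    refine Measurable.of_comap_le ?_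
    exact le_iSup (fun τ : Fin t => MeasurableSpace.comap (S τ) ⊤) ⟨τ, Finset.mem_range.1 hτ⟩
  exact (@measurable_from_top _ _ _ fun A : Finset L => if s ∈ A then (1 : ℝ) else 0).comp h1

variable [Fintype L] [MeasurableSpace Ω] [Fintype R] [DecidableEq R]

/-- Given the history, a favourable sample has a probability that is exponentially small only in
`δ²` times the number of observations of the unit. -/
lemma mul_measureReal_le_measureReal_selected {P : Measure Ω} [IsProbabilityMeasure P]
    {E : Finset (L × R)} {x : E → ℝ} {K : ℕ} [NeZero K] {init : L → Finset L}
    (hinit : IsInit K init) {θ : ℕ → Ω → E → ℝ} {S : ℕ → Ω → Finset L}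
    (hrun : IsCTSRun P (pmcUnit E) (pmcReward E) K x init θ S) {e₀ : E} {δ : ℝ} (hδ : 0 ≤ δ)
    (hgap : ∀ u, pmcReward E {u} x - pmcReward E {e₀.1.1} x ≤ δ) (ℓ : ℝ) (t : ℕ) :
    gaussianConst ^ Fintype.card E * Real.exp (-(δ ^ 2 * (ℓ + Fintype.card L))) *
        P.real {ω | selections S e₀.1.1 t ω ≤ ℓ} ≤ P.real {ω | e₀.1.1 ∈ S t ω} := by
  set B := favourable x (fun e => pmcUnit E e = e₀.1.1) e₀ δ with hBdef
  set A := {ω | selections S e₀.1.1 t ω ≤ ℓ} with hAdef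
  have hB : MeasurableSet B := measurableSet_favourable _ _ _ _
  have hle := history_le hrun.measurable_action t
  have hA : MeasurableSet[history S t] A :=
    measurable_selections_history S e₀.1.1 t measurableSet_Iic
  have hθB : MeasurableSet (θ t ⁻¹' B) := hrun.measurable_param t hB
  have hint : Integrable ((θ t ⁻¹' B).indicator fun _ => (1 : ℝ)) P :=
    (integrable_const _).indicator hθB
  have hlow : ∀ᵐ ω ∂P, ω ∈ A →
      gaussianConst ^ Fintype.card E * Real.exp (-(δ ^ 2 * (ℓ + Fintype.card L))) ≤
        (P[(θ t ⁻¹' B).indicator (fun _ => (1 : ℝ)) | history S t]) ω := by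
    filter_upwards [hrun.condLaw_param t B hB] with ω hω hωA
    rw [hω]
    have hmean : (stats (pmcUnit E) x init (fun τ => S τ ω) t).mean = x :=
      funext fun i => mean_stats _ x hinit _ t i
    have hpost := posterior_real_favourable_ge (stats (pmcUnit E) x init (fun τ => S τ ω) t)
      (one_le_count_stats _ x hinit _ t) (p := fun e => pmcUnit E e = e₀.1.1) (i₀ := e₀) rfl hδ
    rw [hmean] at hpost
    refine le_trans ?_ hpost
    refine mul_le_mul_of_nonneg_left (Real.exp_le_exp.2 (neg_le_neg ?_))
      (pow_nonneg gaussianConst_pos.le _)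
    refine mul_le_mul_of_nonneg_left ?_ (sq_nonneg δ)
    refine (count_stats_le _ x init (fun τ => S τ ω) t e₀).trans ?_
    have : selections S e₀.1.1 t ω ≤ ℓ := hωA
    exact add_le_add_left this _
  have h1 := setIntegral_mono_on_ae (integrable_const _).integrableOn
    integrable_condExp.integrableOn (hle _ hA) hlow
  rw [setIntegral_condExp hle hint hA, setIntegral_const, smul_eq_mul, mul_comm,
    setIntegral_indicator hθB, setIntegral_const, smul_eq_mul, mul_one] at h1
  refine h1.trans (measureReal_mono fun ω hω => ?_)
  obtain ⟨g, hg, hSg⟩ := hrun.greedy t ω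
  change _ ∈ S t ω
  rw [hSg]
  exact mem_action_of_favourable hgap hω.2 hg

/-- With probability at least one half the unit is selected more than `ℓ` times, or else each of
the `T` rounds selects it with at least half of the probability of a favourable sample. -/
lemma min_le_expectedSelections {P : Measure Ω} [IsProbabilityMeasure P]
    {E : Finset (L × R)} {x : E → ℝ} {K : ℕ} [NeZero K] {init : L → Finset L}
    (hinit : IsInit K init) {θ : ℕ → Ω → E → ℝ} {S : ℕ → Ω → Finset L}
    (hrun : IsCTSRun P (pmcUnit E) (pmcReward E) K x init θ S) {e₀ : E} {δ : ℝ} (hδ : 0 ≤ δ)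
    (hgap : ∀ u, pmcReward E {u} x - pmcReward E {e₀.1.1} x ≤ δ) {ℓ : ℝ} (hℓ : 0 ≤ ℓ) (T : ℕ) :
    min (ℓ / 2) (T * (gaussianConst ^ Fintype.card E *
        Real.exp (-(δ ^ 2 * (ℓ + Fintype.card L)))) / 2) ≤
      expectedSelections P S e₀.1.1 T := by
  set s := e₀.1.1 with hs
  set q := gaussianConst ^ Fintype.card E * Real.exp (-(δ ^ 2 * (ℓ + Fintype.card L))) with hq
  have hq0 : 0 ≤ q := mul_nonneg (pow_nonneg gaussianConst_pos.le _) (Real.exp_pos _).le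
  have hEint : ∀ t, Integrable (fun ω => if s ∈ S t ω then (1 : ℝ) else 0) P := fun t =>
    integrable_comp_action (hrun.measurable_action t) fun A => if s ∈ A then (1 : ℝ) else 0
  have hmS : ∀ t, MeasurableSet {ω | s ∈ S t ω} := fun t =>
    measurable_of_measurableSet_eq (hrun.measurable_action t) (t := {A | s ∈ A}) trivial
  have hE : expectedSelections P S s T = ∑ t ∈ Finset.range T, P.real {ω | s ∈ S t ω} := by
    unfold expectedSelections
    rw [integral_finsetSum _ fun t _ => hEint t]
    refine Finset.sum_congr rfl fun t _ => ?_
    rw [← integral_indicator_one (hmS t)]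
    refine integral_congr_ae (ae_of_all _ fun ω => ?_)
    simp [Set.indicator_apply]
  have hmeas : Measurable (selections S s T) :=
    (measurable_selections_history S s T).mono (history_le hrun.measurable_action T) le_rfl
  have hA : MeasurableSet {ω | selections S s T ω ≤ ℓ} := hmeas measurableSet_Iic
  rcases le_total (1 / 2) (P.real {ω | selections S s T ω ≤ ℓ}) with hp | hp
  · refine (min_le_right _ _).trans ?_
    have hT : ∀ t ∈ Finset.range T, q / 2 ≤ P.real {ω | s ∈ S t ω} := by
      intro t ht
      have h1 := mul_measureReal_le_measureReal_selected hinit hrun hδ hgap ℓ t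
      have h2 : P.real {ω | selections S s T ω ≤ ℓ} ≤ P.real {ω | selections S s t ω ≤ ℓ} :=
        measureReal_mono fun ω hω =>
          (selections_mono S s ω (Finset.mem_range.1 ht).le).trans hω
      refine le_trans ?_ h1
      rw [div_eq_mul_one_div]
      exact mul_le_mul_of_nonneg_left (hp.trans h2) hq0
    have := Finset.card_nsmul_le_sum _ _ _ hT
    rw [Finset.card_range, nsmul_eq_mul, ← hE] at this
    linarith
  · refine (min_le_left _ _).trans ?_
    have hint : Integrable (selections S s T) P := by
      unfold selections
      exact integrable_finsetSum _ fun t _ => hEint t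
    have h1 := mul_meas_ge_le_integral_of_nonneg (μ := P)
      (ae_of_all _ fun ω => show 0 ≤ selections S s T ω from
        Finset.sum_nonneg fun t _ => by split_ifs <;> norm_num) hint ℓ
    have h2 : P.real {ω | selections S s T ω ≤ ℓ}ᶜ ≤ P.real {ω | ℓ ≤ selections S s T ω} :=
      measureReal_mono fun ω hω => by
        rw [Set.mem_compl_iff, Set.mem_ofPred_eq, not_le] at hω
        exact hω.le
    rw [probReal_compl_eq_one_sub hA] at h2
    have h3 : ℓ * (1 / 2) ≤ ℓ * P.real {ω | ℓ ≤ selections S s T ω} :=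
      mul_le_mul_of_nonneg_left (by linarith) hℓ
    have h4 : ∫ ω, selections S s T ω ∂P = expectedSelections P S s T := rfl
    linarith [h1.trans_eq h4]

end Selections

/-! ### Logarithmic growth -/

/-- When the threshold is `log T / (2 δ²)`, favourable samples have probability of order `T ^ (-1/2)`,
so `T` rounds contain of order `T ^ (1/2)` of them. -/
lemma eventually_log_div_le {κ δ : ℝ} (hκ : 0 < κ) (hδ : 0 < δ) (n : ℝ) :
    ∀ᶠ T : ℕ in Filter.atTop, Real.log T / (4 * δ ^ 2) ≤
      T * (κ * Real.exp (-(δ ^ 2 * (Real.log T / (2 * δ ^ 2) + n)))) / 2 := by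
  have hD : 0 < κ * Real.exp (-(δ ^ 2 * n)) / 2 * (4 * δ ^ 2) := by positivity
  have h := (isLittleO_log_rpow_atTop (r := 1 / 2) (by norm_num)).def hD
  filter_upwards [tendsto_natCast_atTop_atTop.eventually h, Filter.eventually_gt_atTop 0]
    with T hT hT0
  have hT0' : (0 : ℝ) < T := by exact_mod_cast hT0
  have h1 : Real.log T ≤
      κ * Real.exp (-(δ ^ 2 * n)) / 2 * (4 * δ ^ 2) * (T : ℝ) ^ (1 / 2 : ℝ) := by
    have := (Real.le_norm_self _).trans hT
    rwa [Real.norm_of_nonneg (by positivity)] at this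
  have h2 : Real.exp (-(δ ^ 2 * (Real.log T / (2 * δ ^ 2) + n))) =
      Real.exp (-(δ ^ 2 * n)) * Real.exp (-(Real.log T / 2)) := by
    rw [← Real.exp_add]
    congr 1
    field_simp
    ring
  have h3 : (T : ℝ) * Real.exp (-(Real.log T / 2)) = (T : ℝ) ^ (1 / 2 : ℝ) := by
    rw [Real.rpow_def_of_pos hT0']
    nth_rewrite 1 [← Real.exp_log hT0']
    rw [← Real.exp_add]
    congr 1
    ring
  rw [h2, div_le_iff₀ (by positivity)]
  refine h1.trans_eq ?_
  rw [← h3]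
  ring

/-! ### The instance -/

lemma pmcReward_edges (Δ : ℝ) (S : Finset (Fin 4)) :
    pmcReward edges S (weights Δ) =
      (1 - (if 0 ∈ S then 0.51 else 1) * (if 1 ∈ S then 0.8 else 1) *
        (if 2 ∈ S then 0.7 else 1)) +
      (1 - (if 1 ∈ S then 0.7 else 1) * (if 2 ∈ S then 0.8 + Δ else 1) *
        (if 3 ∈ S then 0.52 else 1)) := by
  have huniv : (Finset.univ : Finset edges) = {⟨(0, 0), by decide⟩, ⟨(1, 0), by decide⟩,
      ⟨(1, 1), by decide⟩, ⟨(2, 0), by decide⟩, ⟨(2, 1), by decide⟩, ⟨(3, 1), by decide⟩} := by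
    decide
  have h0 : ∀ f : edges → ℝ, (∏ e : edges with e.1.2 = 0 ∧ e.1.1 ∈ S, f e) =
      (if 0 ∈ S then f ⟨(0, 0), by decide⟩ else 1) * (if 1 ∈ S then f ⟨(1, 0), by decide⟩ else 1) *
        (if 2 ∈ S then f ⟨(2, 0), by decide⟩ else 1) := by
    intro f
    rw [Finset.prod_filter, huniv]
    simp [mul_assoc]
  have h1 : ∀ f : edges → ℝ, (∏ e : edges with e.1.2 = 1 ∧ e.1.1 ∈ S, f e) =
      (if 1 ∈ S then f ⟨(1, 1), by decide⟩ else 1) * (if 2 ∈ S then f ⟨(2, 1), by decide⟩ else 1) *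
        (if 3 ∈ S then f ⟨(3, 1), by decide⟩ else 1) := by
    intro f
    rw [Finset.prod_filter, huniv]
    simp [mul_assoc]
  rw [pmcReward, Fin.sum_univ_two, h0, h1]
  simp only [weights, weightMatrix, Matrix.of_apply, Matrix.cons_val]
  have e1 : (1 : ℝ) - 0.49 = 0.51 := by norm_num
  have e2 : (1 : ℝ) - 0.2 = 0.8 := by norm_num
  have e3 : (1 : ℝ) - 0.3 = 0.7 := by norm_num
  have e4 : (1 : ℝ) - (0.2 - Δ) = 0.8 + Δ := by ring
  have e5 : (1 : ℝ) - 0.48 = 0.52 := by norm_num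
  rw [e1, e2, e3, e4, e5]

lemma before_zero (g : Fin 2 → Fin 4) : before g 0 = ∅ := by
  have : Finset.Iio (0 : Fin 2) = ∅ := by decide
  simp [before, this]

lemma before_one (g : Fin 2 → Fin 4) : before g 1 = {g 0} := by
  have : Finset.Iio (1 : Fin 2) = {0} := by decide
  simp [before, this]

lemma action_eq (g : Fin 2 → Fin 4) : action g = {g 0, g 1} := by
  have : (Finset.univ : Finset (Fin 2)) = {0, 1} := by decide
  simp [action, this, Finset.image_insert]

/-- Greedy on the true means chooses `u₂`, whose reward is `0.5`, and then `u₁`, which raises the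
reward to `0.892`. -/
lemma isGreedySeq_weights_iff {Δ : ℝ} (h0 : 0 < Δ) (h1 : Δ ≤ 0.04) (g : Fin 2 → Fin 4) :
    IsGreedySeq (pmcReward edges) (weights Δ) g ↔ g = ![u₂, u₁] := by
  unfold u₁ u₂
  rw [IsGreedySeq, Fin.forall_fin_two, before_zero, before_one]
  simp only [Fin.isValue, insert_empty_eq, Finset.notMem_empty, not_false_eq_true, true_and,
    forall_const, Finset.mem_singleton, pmcReward_edges, Finset.mem_insert]
  constructor
  · rintro ⟨h, hne, h'⟩
    have hg0 : g 0 = 1 := by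
      have := h 1
      generalize g 0 = a at this
      fin_cases a <;> simp at this ⊢ <;> norm_num at this <;> linarith
    have hg1 : g 1 = 0 := by
      rw [hg0] at hne h'
      have := h' 0 (by decide)
      generalize g 1 = a at this hne
      fin_cases a <;> simp at this hne ⊢ <;> norm_num at this <;> linarith
    funext k
    fin_cases k <;> simp [hg0, hg1]
  · rintro rfl
    refine ⟨fun u => ?_, by decide, fun u hu => ?_⟩
    · fin_cases u <;> simp <;> norm_num <;> linarith
    · fin_cases u <;> simp at hu ⊢ <;> norm_num <;> linarith

lemma marginalGap_zero (Δ : ℝ) (s : Fin 4) :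
    marginalGap (pmcReward edges) (weights Δ) ![u₂, u₁] s 0 =
      pmcReward edges {u₂} (weights Δ) - pmcReward edges {s} (weights Δ) := by
  simp [marginalGap, before_zero]

lemma marginalGap_u₃ (Δ : ℝ) :
    marginalGap (pmcReward edges) (weights Δ) ![u₂, u₁] u₃ 0 = Δ := by
  rw [marginalGap_zero, pmcReward_edges, pmcReward_edges]
  unfold u₂ u₃
  simp
  ring

lemma reward_singleton_le {Δ : ℝ} (h0 : 0 < Δ) (u : Fin 4) :
    pmcReward edges {u} (weights Δ) ≤ pmcReward edges {u₂} (weights Δ) := by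
  unfold u₂
  rw [pmcReward_edges, pmcReward_edges]
  fin_cases u <;> simp <;> norm_num <;> linarith

lemma marginalGap_pos {Δ : ℝ} (h0 : 0 < Δ) {s : Fin 4} (hs : s ≠ u₂) :
    0 < marginalGap (pmcReward edges) (weights Δ) ![u₂, u₁] s 0 := by
  rw [marginalGap_zero, pmcReward_edges, pmcReward_edges]
  unfold u₂ at *
  fin_cases s <;> simp at hs ⊢ <;> norm_num <;> linarith

/-- Every action that contains `u₃` loses at least `0.008` against the greedy action; the smallest
loss is that of `{u₃, u₄}`. -/
lemma mul_indicator_le_regret {Δ : ℝ} (h0 : 0 < Δ) {w : edges → ℝ} {g : Fin 2 → Fin 4}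
    (hg : IsGreedySeq (pmcReward edges) w g) :
    0.008 * (if u₃ ∈ action g then (1 : ℝ) else 0) ≤
      max (pmcReward edges (action ![u₂, u₁]) (weights Δ) -
        pmcReward edges (action g) (weights Δ)) 0 := by
  unfold u₁ u₂ u₃
  by_cases hmem : 2 ∈ action g
  · rw [if_pos hmem]
    refine le_max_of_le_left ?_
    have hne := (hg 1).1
    rw [before_one] at hne
    rw [action_eq] at hmem
    rw [pmcReward_edges, pmcReward_edges, action_eq, action_eq]
    generalize g 0 = a at hmem hne
    generalize g 1 = b at hmem hne
    fin_cases a <;> fin_cases b <;> simp at hmem hne ⊢ <;> norm_num <;> linarith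
  · simp [hmem]

lemma mul_expectedSelections_le_greedyRegret {Δ : ℝ} (h0 : 0 < Δ) {Ω : Type*} [MeasurableSpace Ω]
    {P : Measure Ω} [IsProbabilityMeasure P] {init : Fin 4 → Finset (Fin 4)}
    {θ : ℕ → Ω → edges → ℝ} {S : ℕ → Ω → Finset (Fin 4)}
    (hrun : IsCTSRun P (pmcUnit edges) (pmcReward edges) 2 (weights Δ) init θ S) (T : ℕ) :
    0.008 * expectedSelections P S u₃ T ≤
      greedyRegret P (pmcReward edges) (weights Δ) (action ![u₂, u₁]) S T := by
  unfold expectedSelections greedyRegret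
  rw [← integral_const_mul]
  refine integral_mono ?_ ?_ fun ω => ?_
  · exact (integrable_finsetSum _ fun t _ => integrable_comp_action (hrun.measurable_action t)
      fun A => if u₃ ∈ A then (1 : ℝ) else 0).const_mul _
  · exact integrable_finsetSum _ fun t _ => integrable_comp_action (hrun.measurable_action t)
      fun A => max (pmcReward edges (action ![u₂, u₁]) (weights Δ) -
        pmcReward edges A (weights Δ)) 0
  · simp only [Finset.mul_sum]
    refine Finset.sum_le_sum fun t _ => ?_
    obtain ⟨g, hg, hS⟩ := hrun.greedy t ω
    rw [hS]
    exact mul_indicator_le_regret h0 hg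

end CMAB

theorem theorem1 :
    ∃ c : ℝ, 0 < c ∧ ∀ Δ : ℝ, 0 < Δ → Δ ≤ 0.04 →
      (∀ g : Fin 2 → Fin 4,
        CMAB.IsGreedySeq (CMAB.pmcReward CMAB.edges) (CMAB.weights Δ) g ↔
          g = ![CMAB.u₂, CMAB.u₁]) ∧
      ∃ T₀ : ℕ, ∀ T : ℕ, T₀ ≤ T →
        ∀ init : Fin 4 → Finset (Fin 4), CMAB.IsInit 2 init →
        ∀ (Ω : Type*) [MeasurableSpace Ω] (P : Measure Ω) [IsProbabilityMeasure P]
          (θ : ℕ → Ω → CMAB.edges → ℝ) (S : ℕ → Ω → Finset (Fin 4)),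
          CMAB.IsCTSRun P (CMAB.pmcUnit CMAB.edges) (CMAB.pmcReward CMAB.edges) 2
            (CMAB.weights Δ) init θ S →
          (∀ s : Fin 4, s ≠ CMAB.u₂ →
            c * (Real.log T /
              CMAB.marginalGap (CMAB.pmcReward CMAB.edges) (CMAB.weights Δ)
                ![CMAB.u₂, CMAB.u₁] s 0 ^ 2) ≤ CMAB.expectedSelections P S s T) ∧
          c * (Real.log T /
            CMAB.marginalGap (CMAB.pmcReward CMAB.edges) (CMAB.weights Δ)
              ![CMAB.u₂, CMAB.u₁] CMAB.u₃ 0 ^ 2) ≤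
            CMAB.greedyRegret P (CMAB.pmcReward CMAB.edges) (CMAB.weights Δ)
              (CMAB.action ![CMAB.u₂, CMAB.u₁]) S T ∧
          c * (Real.log T / Δ ^ 2) ≤
            CMAB.greedyRegret P (CMAB.pmcReward CMAB.edges) (CMAB.weights Δ)
              (CMAB.action ![CMAB.u₂, CMAB.u₁]) S T := by
  -- `0.002 = 0.008 / 4`: a threshold `log T / (2 δ²)` exceeded with probability one half gives
  -- `log T / (4 δ²)` selections, and a round with `u₃` has regret at least `0.008`.
  refine ⟨0.002, by norm_num, fun Δ h0 h1 => ⟨CMAB.isGreedySeq_weights_iff h0 h1, ?_⟩⟩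
  have hev : ∀ᶠ T : ℕ in Filter.atTop, ∀ s : Fin 4, s ≠ CMAB.u₂ → _ :=
    Filter.eventually_all.2 fun s => Filter.eventually_imp_distrib_left.2 fun hs =>
      CMAB.eventually_log_div_le
        (pow_pos CMAB.gaussianConst_pos (Fintype.card CMAB.edges))
        (CMAB.marginalGap_pos h0 hs) (Fintype.card (Fin 4))
  obtain ⟨T₀, hT₀⟩ := Filter.eventually_atTop.1 hev
  refine ⟨T₀, fun T hT init hinit Ω _ P _ θ S hrun => ?_⟩
  have hlog : 0 ≤ Real.log T := Real.log_natCast_nonneg T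
  have hsel : ∀ s : Fin 4, s ≠ CMAB.u₂ →
      Real.log T / (4 * CMAB.marginalGap (CMAB.pmcReward CMAB.edges) (CMAB.weights Δ)
        ![CMAB.u₂, CMAB.u₁] s 0 ^ 2) ≤ CMAB.expectedSelections P S s T := by
    intro s hs
    have hpos := CMAB.marginalGap_pos h0 hs
    have hlarge := hT₀ T hT s hs
    obtain ⟨e₀, rfl⟩ : ∃ e : CMAB.edges, e.1.1 = s := by
      fin_cases s
      exacts [⟨⟨(0, 0), by decide⟩, rfl⟩, ⟨⟨(1, 0), by decide⟩, rfl⟩,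
        ⟨⟨(2, 0), by decide⟩, rfl⟩, ⟨⟨(3, 1), by decide⟩, rfl⟩]
    refine le_trans (le_min ?_ hlarge) (CMAB.min_le_expectedSelections hinit hrun hpos.le
      (fun u => ?_) (div_nonneg hlog (by positivity)) T)
    · rw [div_div]
      exact le_of_eq (by ring)
    · rw [CMAB.marginalGap_zero]
      linarith [CMAB.reward_singleton_le h0 u]
  have hreg : 0.002 * (Real.log T / Δ ^ 2) ≤
      CMAB.greedyRegret P (CMAB.pmcReward CMAB.edges) (CMAB.weights Δ)
        (CMAB.action ![CMAB.u₂, CMAB.u₁]) S T := by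
    refine le_trans ?_ (CMAB.mul_expectedSelections_le_greedyRegret h0 hrun T)
    have h := hsel CMAB.u₃ (by decide)
    rw [CMAB.marginalGap_u₃, mul_comm 4, ← div_div] at h
    linarith
  refine ⟨fun s hs => ?_, ?_, hreg⟩
  · refine le_trans ?_ (hsel s hs)
    rw [mul_comm 4, ← div_div]
    have := div_nonneg hlog (sq_nonneg (CMAB.marginalGap (CMAB.pmcReward CMAB.edges)
      (CMAB.weights Δ) ![CMAB.u₂, CMAB.u₁] s 0))
    linarith
  · rwa [CMAB.marginalGap_u₃]
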